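/- Let $\mathcal H$ be a separable complex Hilbert space (possibly finite-dimensional). A bounded operator $A$ on $\mathcal H$ is a partial isometry if $A^*A$ and $AA^*$ are self-adjoint projections, and a set of bounded operators is irreducible if its only common closed invariant subspaces are $\{0\}$ and the whole space. For $k\in\mathbb N\cup\{\infty\}$, $k\ge 1$, and a group $\mathcal U$ of unitary $r\times r$ matrices, let $\mathcal S_1^k(\mathcal U)$ be the set of bounded operators on the Hilbert space direct sum $\bigoplus_{i=1}^k\mathbb C^r$ whose $k\times k$ block matrix (with $r\times r$ blocks) has at most one non-zero block in each block row and in each block column, every non-zero block belonging to $\mathcal U$; let $\mathcal S_0^k(\mathcal U)$ be the set of those operators whose block matrix has at most one non-zero block altogether, that block belonging to $\mathcal U$. **Theorem.** Let $\mathcal S$ be an irreducible norm-closed semigroup (with respect to composition, not necessarily self-adjoint) of partial isometries on $\mathcal H$ which contains a non-zero compact operator. Then there exist $k\in\mathbb N\cup\{\infty\}$, $k\ge1$, an irreducible group $\mathcal U$ of unitary $r_0\times r_0$ matrices, where $r_0$ is the minimal rank of the non-zero operators in $\mathcal S$ (in particular, this minimum is finite), and a unitary $W:\mathcal H\to\bigoplus_{i=1}^k\mathbb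 C^{r_0}$ such that $$\mathcal S_0^k(\mathcal U)\setminus\{0\}\subseteq W\mathcal S W^{-1}\subseteq \mathcal S_1^k(\mathcal U).$$ Moreover, $\mathcal S_0^k(\mathcal U)\subseteq W\mathcal S W^{-1}$, except possibly when $k=1$ and $0\notin\mathcal S$. -/

import Mathlib

open scoped ENNReal

namespace PartialIsometrySemigroup

/-- A bounded operator `A` on a Hilbert space is a partial isometry if `A* A` and `A A*` are both
self-adjoint projections. -/
def IsPartialIsometry {H : Type*} [NormedAddCommGroup H] [InnerProductSpace ℂ H] [CompleteSpace H]
    (A : H →L[ℂ] H) : Prop :=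
  IsStarProjection (ContinuousLinearMap.adjoint A * A) ∧
    IsStarProjection (A * ContinuousLinearMap.adjoint A)

/-- A set of bounded operators is irreducible if its only common closed invariant subspaces are
the trivial ones. -/
def IsIrreducibleFamily {H : Type*} [NormedAddCommGroup H] [InnerProductSpace ℂ H]
    (S : Set (H →L[ℂ] H)) : Prop :=
  ∀ M : Submodule ℂ H, IsClosed (M : Set H) → (∀ A ∈ S, ∀ x ∈ M, A x ∈ M) → M = ⊥ ∨ M = ⊤

/-- The set of ranks (dimensions of the ranges, as cardinals) of the nonzero operators in `S`. -/
def nonzeroRanks {H : Type*} [NormedAddCommGroup H] [InnerProductSpace ℂ H]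
    (S : Set (H →L[ℂ] H)) : Set Cardinal :=
  {c | ∃ A ∈ S, A ≠ 0 ∧ (A : H →ₗ[ℂ] H).rank = c}

/-- For `k ∈ ℕ ∪ {∞}`, an index set with exactly `k` elements. -/
abbrev Index (k : ℕ∞) : Type := {i : ℕ // (i : ℕ∞) < k}

/-- `𝒮₀ᵏ`: the matrices with at most one nonzero entry, that entry being equal to one. -/
def pattern₀ (ι : Type*) : Set (Matrix ι ι ℂ) :=
  {M | (∀ i j, M i j ≠ 0 → M i j = 1) ∧
    ∀ i j i' j', M i j ≠ 0 → M i' j' ≠ 0 → i = i' ∧ j = j'}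

/-- `𝒮₁ᵏ`: the matrices with at most one nonzero entry in every row and in every column, each
such entry being equal to one. -/
def pattern₁ (ι : Type*) : Set (Matrix ι ι ℂ) :=
  {M | (∀ i j, M i j ≠ 0 → M i j = 1) ∧
    (∀ i j j', M i j ≠ 0 → M i j' ≠ 0 → j = j') ∧
    (∀ i i' j, M i j ≠ 0 → M i' j ≠ 0 → i = i')}

/-- The Hilbert space direct sum of copies of `K` indexed by `ι`. -/
abbrev DirectSumSpace (ι K : Type*) [NormedAddCommGroup K] : Type _ :=
  lp (fun _ : ι => K) 2

/-- `B` is the operator matrix of the operator `T` on the direct sum of copies of `K`: the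
`i`-th component of `T` applied to `x` placed in the `j`-th summand is `B i j x`. -/
def IsOperatorMatrix {ι K : Type*} [DecidableEq ι] [NormedAddCommGroup K] [InnerProductSpace ℂ K]
    (B : Matrix ι ι (K →L[ℂ] K)) (T : DirectSumSpace ι K →L[ℂ] DirectSumSpace ι K) : Prop :=
  ∀ i j x, T (lp.single 2 j x) i = B i j x

/-- The operators on the direct sum whose matrices are obtained from the matrices in `P` by
replacing the nonzero entries by elements of `U` and the zero entries by zero operators. -/
def inflate {ι K : Type*} [DecidableEq ι] [NormedAddCommGroup K] [InnerProductSpace ℂ K]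
    (P : Set (Matrix ι ι ℂ)) (U : Set (K →L[ℂ] K)) :
    Set (DirectSumSpace ι K →L[ℂ] DirectSumSpace ι K) :=
  {T | ∃ B : Matrix ι ι (K →L[ℂ] K), IsOperatorMatrix B T ∧
    ∃ M ∈ P, ∀ i j, (M i j = 0 → B i j = 0) ∧ (M i j ≠ 0 → B i j ∈ U)}

/-- `𝒮₀ᵏ(U)`. -/
def S₀ {K : Type*} [NormedAddCommGroup K] [InnerProductSpace ℂ K] (k : ℕ∞)
    (U : Set (K →L[ℂ] K)) :
    Set (DirectSumSpace (Index k) K →L[ℂ] DirectSumSpace (Index k) K) :=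
  inflate (pattern₀ (Index k)) U

/-- `𝒮₁ᵏ(U)`. -/
def S₁ {K : Type*} [NormedAddCommGroup K] [InnerProductSpace ℂ K] (k : ℕ∞)
    (U : Set (K →L[ℂ] K)) :
    Set (DirectSumSpace (Index k) K →L[ℂ] DirectSumSpace (Index k) K) :=
  inflate (pattern₁ (Index k)) U

/-- The operators on `ℂʳ` (with its Euclidean norm) given by the members of a group of unitary
`r × r` matrices. -/
def unitaryOperators {r : ℕ} (U : Subgroup (Matrix.unitaryGroup (Fin r) ℂ)) :
    Set (EuclideanSpace ℂ (Fin r) →L[ℂ] EuclideanSpace ℂ (Fin r)) :=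
  {A | ∃ u ∈ U, Matrix.toEuclideanCLM (n := Fin r) (𝕜 := ℂ) (u : Matrix (Fin r) (Fin r) ℂ) = A}

/-- The image `W S W⁻¹` of a set of operators under a unitary equivalence `W`. -/
def conjugate {H K : Type*} [NormedAddCommGroup H] [InnerProductSpace ℂ H] [CompleteSpace H]
    [NormedAddCommGroup K] [InnerProductSpace ℂ K] [CompleteSpace K]
    (W : H ≃ₗᵢ[ℂ] K) (S : Set (H →L[ℂ] H)) : Set (K →L[ℂ] K) :=
  W.conjStarAlgEquiv '' S

end PartialIsometrySemigroup

/-!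
Let `A ∈ S` have the least nonzero rank; such operators exist and have finite rank because a compact
partial isometry has finite rank. If `B ∈ S` also has the least rank and `B A ≠ 0`, then `B A` is a
partial isometry of the same finite rank, which forces `B* B = A A*`.

An operator of least rank with equal initial and final spaces acts there as a unitary on a
finite-dimensional space. The unitary group is compact, so the closed semigroup `S` contains the
adjoint of such an operator, and irreducibility extends this to every operator of least rank. The
projections `A A*` therefore lie in `S`; they are pairwise orthogonal, and their ranges span a dense
subspace invariant under `S`. The operators of least rank connecting these ranges provide matrix
units in `S`, and in terms of them all the corners of `S` become one group of unitaries, together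
with `0` if it belongs to `S`.
-/

namespace PartialIsometrySemigroup

open scoped InnerProduct

section CStarRing

variable {R : Type*} [NormedRing R] [StarRing R] [CStarRing R]

theorem mul_star_mul_self_of_isStarProjection {a : R} (h : IsStarProjection (star a * a)) :
    a * star a * a = a := by
  have hidem : star a * a * (star a * a) = star a * a := h.isIdempotentElem
  rw [← sub_eq_zero, ← CStarRing.star_mul_self_eq_zero_iff]
  calc star (a * star a * a - a) * (a * star a * a - a)
      = star a * a * (star a * a) * (star a * a) - star a * a * (star a * a)
          - star a * a * (star a * a) + star a * a := by
        simp only [star_sub, star_mul, star_star]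
        noncomm_ring
    _ = 0 := by simp only [hidem, sub_self, zero_sub, neg_add_cancel]

theorem star_mul_self_mul_of_star_mul_self_eq {a b : R} (hb : IsStarProjection (star b * b))
    (h : star (b * a) * (b * a) = star a * a) : star b * b * a = a := by
  have hidem : star b * b * (star b * b) = star b * b := hb.isIdempotentElem
  have hab : star a * (star b * b) * a = star a * a := by
    simpa only [star_mul, mul_assoc] using h
  rw [← sub_eq_zero, ← CStarRing.star_mul_self_eq_zero_iff]
  calc star (star b * b * a - a) * (star b * b * a - a)
      = star a * (star b * b * (star b * b)) * a - star a * (star b * b) * a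
          - star a * (star b * b) * a + star a * a := by
        simp only [star_sub, star_mul, star_star]
        noncomm_ring
    _ = 0 := by simp only [hidem, hab, sub_self, zero_sub, neg_add_cancel]

theorem compactSpace_unitary [ProperSpace R] : CompactSpace (unitary R) := by
  refine isCompact_iff_compactSpace.1 (Metric.isCompact_of_isClosed_isBounded isClosed_unitary ?_)
  rcases subsingleton_or_nontrivial R with _ | _
  · exact (Set.toFinite _).isBounded
  · exact isBounded_iff_forall_norm_le.2 ⟨1, fun u hu => (CStarRing.norm_of_mem_unitary hu).le⟩

/-- In the compact group of unitaries, `u⁻¹` is a cluster point of the positive powers of `u`. -/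
theorem star_mem_of_mem_unitary [ProperSpace R] {T : Subsemigroup R} (hT : IsClosed (T : Set R))
    {u : R} (hu : u ∈ unitary R) (huT : u ∈ T) : star u ∈ T := by
  have := compactSpace_unitary (R := R)
  let v : unitary R := ⟨u, hu⟩
  have hpow (n : ℕ) : u ^ (n + 1) ∈ T := by
    induction n with
    | zero => rwa [zero_add, pow_one]
    | succ n ih => exact pow_succ u (n + 1) ▸ T.mul_mem ih huT
  have hcluster : MapClusterPt (star u) Filter.atTop (fun n : ℕ => u ^ n) := by
    have h : MapClusterPt v⁻¹ Filter.atTop (fun n : ℕ => v ^ n) := by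
      simpa only [zpow_neg_one] using mapClusterPt_self_zpow_atTop_pow v (-1)
    exact h.continuousAt_comp continuous_subtype_val.continuousAt
  refine hT.mem_of_mapClusterPt hcluster (Filter.eventually_atTop.2 ⟨1, fun n hn => ?_⟩)
  exact Nat.sub_add_cancel hn ▸ hpow (n - 1)

end CStarRing

section PartialIsometry

variable {H : Type*} [NormedAddCommGroup H] [InnerProductSpace ℂ H]

theorem rank_mul_le_right (A B : H →L[ℂ] H) :
    ((A * B : H →L[ℂ] H) : H →ₗ[ℂ] H).rank ≤ (B : H →ₗ[ℂ] H).rank :=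
  LinearMap.rank_comp_le_right (B : H →ₗ[ℂ] H) (A : H →ₗ[ℂ] H)

theorem rank_mul_le_left (A B : H →L[ℂ] H) :
    ((A * B : H →L[ℂ] H) : H →ₗ[ℂ] H).rank ≤ (A : H →ₗ[ℂ] H).rank :=
  LinearMap.rank_comp_le_left (B : H →ₗ[ℂ] H) (A : H →ₗ[ℂ] H)

variable [CompleteSpace H]

theorem isStarProjection_eq_of_mul_eq_of_rank_le {P Q : H →L[ℂ] H} (hP : IsStarProjection P)
    (hQ : IsStarProjection Q) (hfin : (P : H →ₗ[ℂ] H).rank < Cardinal.aleph0)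
    (hrank : (Q : H →ₗ[ℂ] H).rank ≤ (P : H →ₗ[ℂ] H).rank) (h : Q * P = P) : P = Q := by
  have hrange : P.range ≤ Q.range := by
    rintro _ ⟨x, rfl⟩
    exact ⟨P x, DFunLike.congr_fun h x⟩
  have : FiniteDimensional ℂ Q.range := Module.rank_lt_aleph0_iff.1 (hrank.trans_lt hfin)
  have hfinrank : Module.finrank ℂ Q.range ≤ Module.finrank ℂ P.range :=
    Cardinal.toNat_le_toNat hrank hfin
  exact ContinuousLinearMap.IsStarProjection.ext hP hQ
    (Submodule.eq_of_le_of_finrank_le hrange hfinrank)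

namespace IsPartialIsometry

variable {A B : H →L[ℂ] H}

theorem star_mul_self (hA : IsPartialIsometry A) : IsStarProjection (star A * A) := hA.1

theorem self_mul_star (hA : IsPartialIsometry A) : IsStarProjection (A * star A) := hA.2

theorem mul_star_mul (hA : IsPartialIsometry A) : A * star A * A = A :=
  mul_star_mul_self_of_isStarProjection hA.star_mul_self

protected theorem star (hA : IsPartialIsometry A) : IsPartialIsometry (star A) := by
  simpa only [IsPartialIsometry, ContinuousLinearMap.star_eq_adjoint,
    ContinuousLinearMap.adjoint_adjoint] using And.symm hA

theorem rank_self_mul_star (hA : IsPartialIsometry A) :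
    ((A * star A : H →L[ℂ] H) : H →ₗ[ℂ] H).rank = (A : H →ₗ[ℂ] H).rank := by
  refine (rank_mul_le_left A (star A)).antisymm ?_
  simpa only [hA.mul_star_mul] using rank_mul_le_left (A * star A) A

theorem rank_star_mul_self (hA : IsPartialIsometry A) :
    ((star A * A : H →L[ℂ] H) : H →ₗ[ℂ] H).rank = (A : H →ₗ[ℂ] H).rank := by
  refine (rank_mul_le_right (star A) A).antisymm ?_
  simpa only [← mul_assoc, hA.mul_star_mul] using rank_mul_le_right A (star A * A)

theorem rank_star (hA : IsPartialIsometry A) :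
    ((star A : H →L[ℂ] H) : H →ₗ[ℂ] H).rank = (A : H →ₗ[ℂ] H).rank := by
  rw [← hA.star.rank_star_mul_self, star_star, hA.rank_self_mul_star]

theorem self_mul_star_eq_of_rank_le (hA : IsPartialIsometry A) (hB : IsPartialIsometry B)
    (hfin : (B : H →ₗ[ℂ] H).rank < Cardinal.aleph0)
    (hrank : (A : H →ₗ[ℂ] H).rank ≤ (B : H →ₗ[ℂ] H).rank) (h : A * star A * B = B) :
    B * star B = A * star A := by
  refine isStarProjection_eq_of_mul_eq_of_rank_le hB.self_mul_star hA.self_mul_star ?_ ?_ ?_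
  · rwa [hB.rank_self_mul_star]
  · rwa [hA.rank_self_mul_star, hB.rank_self_mul_star]
  · rw [← mul_assoc, h]

theorem star_mul_self_eq_of_rank_le (hA : IsPartialIsometry A) (hB : IsPartialIsometry B)
    (hfin : (B : H →ₗ[ℂ] H).rank < Cardinal.aleph0)
    (hrank : (A : H →ₗ[ℂ] H).rank ≤ (B : H →ₗ[ℂ] H).rank) (h : B * (star A * A) = B) :
    star B * B = star A * A := by
  simpa only [star_star] using hA.star.self_mul_star_eq_of_rank_le hB.star
    (by rwa [hB.rank_star]) (by rwa [hA.rank_star, hB.rank_star])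
    (by simpa only [star_mul, star_star] using congrArg star h)

/-- The defect `A* A - (BA)* (BA)` vanishes by comparison of ranks, so that `B` is isometric on the
final space of `A`. -/
theorem star_mul_self_eq_self_mul_star (hA : IsPartialIsometry A) (hB : IsPartialIsometry B)
    (hBA : IsPartialIsometry (B * A)) (hfin : (A : H →ₗ[ℂ] H).rank < Cardinal.aleph0)
    (hrank : (B : H →ₗ[ℂ] H).rank ≤ (A : H →ₗ[ℂ] H).rank)
    (hrank' : (A : H →ₗ[ℂ] H).rank ≤ ((B * A : H →L[ℂ] H) : H →ₗ[ℂ] H).rank) :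
    star B * B = A * star A := by
  have hinitial : star (B * A) * (B * A) = star A * A :=
    hA.star_mul_self_eq_of_rank_le hBA ((rank_mul_le_right B A).trans_lt hfin) hrank'
      (by rw [mul_assoc, ← mul_assoc A, hA.mul_star_mul])
  have hfix : star B * B * A = A := star_mul_self_mul_of_star_mul_self_eq hB.star_mul_self hinitial
  refine (isStarProjection_eq_of_mul_eq_of_rank_le hA.self_mul_star hB.star_mul_self ?_ ?_ ?_).symm
  · rwa [hA.rank_self_mul_star]
  · rwa [hA.rank_self_mul_star, hB.rank_star_mul_self]
  · rw [← mul_assoc, hfix]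

/-- The identity of the range of `A`, which is the restriction of `A A*`, is compact. -/
theorem rank_lt_aleph0_of_isCompactOperator (hA : IsPartialIsometry A)
    (hc : IsCompactOperator A) : (A : H →ₗ[ℂ] H).rank < Cardinal.aleph0 := by
  set P : H →L[ℂ] H := A * star A
  have hP : IsStarProjection P := hA.self_mul_star
  have hPc : IsCompactOperator (P : H →ₗ[ℂ] H) := hc.comp_clm (star A)
  have hfix (x : H) (hx : x ∈ P.range) : P x = x := by
    obtain ⟨y, rfl⟩ := hx
    exact DFunLike.congr_fun hP.isIdempotentElem y
  have hid : IsCompactOperator (id : P.range → P.range) := by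
    convert hPc.restrict (V := P.range) (fun x _ => ⟨x, rfl⟩)
      (ContinuousLinearMap.IsIdempotentElem.isClosed_range hP.isIdempotentElem) using 1
    exact funext fun x => Subtype.ext (hfix x x.2).symm
  have := FiniteDimensional.of_isCompactOperator_id (𝕜 := ℂ) hid
  rw [← hA.rank_self_mul_star]
  exact Module.rank_lt_aleph0 ℂ P.range

end IsPartialIsometry

end PartialIsometry

section Block

variable {H K : Type*} [NormedAddCommGroup H] [InnerProductSpace ℂ H] [CompleteSpace H]
  [NormedAddCommGroup K] [InnerProductSpace ℂ K] [CompleteSpace K]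

/-- The operator on `H` that acts as `C` from the range of the isometry `W` to the range of the
isometry `V` and vanishes on the orthogonal complement of the range of `W`. -/
noncomputable def block (V W : K →ₗᵢ[ℂ] H) (C : K →L[ℂ] K) : H →L[ℂ] H :=
  V.toContinuousLinearMap ∘L C ∘L W.toContinuousLinearMap†

/-- The operator on `K` obtained from `T` by restriction to the range of `W` and orthogonal
projection onto the range of `V`, both ranges being identified with `K`. -/
noncomputable def compress (V W : K →ₗᵢ[ℂ] H) (T : H →L[ℂ] H) : K →L[ℂ] K :=
  V.toContinuousLinearMap† ∘L T ∘L W.toContinuousLinearMap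

theorem adjoint_apply_self (V : K →ₗᵢ[ℂ] H) (x : K) : (V.toContinuousLinearMap†) (V x) = x :=
  DFunLike.congr_fun V.adjoint_comp_self x

theorem compress_block (V W : K →ₗᵢ[ℂ] H) (C : K →L[ℂ] K) : compress V W (block V W C) = C := by
  ext x
  simp [compress, block, adjoint_apply_self]

theorem block_injective (V W : K →ₗᵢ[ℂ] H) : Function.Injective (block V W) :=
  Function.LeftInverse.injective (compress_block V W)

theorem block_compress (V W : K →ₗᵢ[ℂ] H) (T : H →L[ℂ] H) :
    block V W (compress V W T) = block V V 1 * T * block W W 1 := rfl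

theorem block_zero (V W : K →ₗᵢ[ℂ] H) : block V W 0 = 0 := by
  simp [block]

theorem block_ne_zero (V W : K →ₗᵢ[ℂ] H) {C : K →L[ℂ] K} (hC : C ≠ 0) : block V W C ≠ 0 :=
  block_zero V W ▸ (block_injective V W).ne hC

theorem block_mul_block (V W X : K →ₗᵢ[ℂ] H) (C D : K →L[ℂ] K) :
    block V W C * block W X D = block V X (C * D) := by
  ext x
  simp [block, adjoint_apply_self]

theorem star_block (V W : K →ₗᵢ[ℂ] H) (C : K →L[ℂ] K) :
    star (block V W C) = block W V (star C) := by
  simp only [block, ContinuousLinearMap.star_eq_adjoint, ContinuousLinearMap.adjoint_comp,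
    ContinuousLinearMap.adjoint_adjoint, ContinuousLinearMap.comp_assoc]

theorem continuous_block (V W : K →ₗᵢ[ℂ] H) : Continuous (block V W) :=
  continuous_const.clm_comp (continuous_id.clm_comp continuous_const)

theorem range_block_one (V : K →ₗᵢ[ℂ] H) : (block V V 1).range = V.toLinearMap.range := by
  refine le_antisymm ?_ ?_
  · rintro _ ⟨x, rfl⟩
    exact ⟨(V.toContinuousLinearMap†) x, rfl⟩
  · rintro _ ⟨x, rfl⟩
    exact ⟨V x, congrArg V (adjoint_apply_self V x)⟩

theorem isStarProjection_block_one (V : K →ₗᵢ[ℂ] H) : IsStarProjection (block V V 1) :=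
  ⟨(block_mul_block V V V 1 1).trans (by rw [mul_one]), (star_block V V 1).trans (by rw [star_one])⟩

theorem exists_block_one_eq {P : H →L[ℂ] H} {r : ℕ} (hP : IsStarProjection P)
    (hr : (P : H →ₗ[ℂ] H).rank = r) :
    ∃ V : EuclideanSpace ℂ (Fin r) →ₗᵢ[ℂ] H, block V V 1 = P := by
  have : FiniteDimensional ℂ P.range :=
    Module.rank_lt_aleph0_iff.1 (hr.trans_lt Cardinal.natCast_lt_aleph0)
  let e : P.range ≃ₗᵢ[ℂ] EuclideanSpace ℂ (Fin r) := ((stdOrthonormalBasis ℂ P.range).reindex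
    (finCongr (Module.finrank_eq_of_rank_eq hr))).repr
  refine ⟨P.range.subtypeₗᵢ.comp e.symm.toLinearIsometry,
    ContinuousLinearMap.IsStarProjection.ext (isStarProjection_block_one _) hP ?_⟩
  rw [range_block_one]
  refine le_antisymm ?_ fun x hx => ⟨e ⟨x, hx⟩, by simp⟩
  rintro _ ⟨x, rfl⟩
  exact (e.symm x).2

end Block

section LeastRank

variable {H : Type*} [NormedAddCommGroup H] [InnerProductSpace ℂ H]

/-- `A` is a nonzero operator of finite rank in `S`, of the least rank among the nonzero operators
in `S`. -/
structure HasLeastRank (S : Subsemigroup (H →L[ℂ] H)) (A : H →L[ℂ] H) : Prop where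
  mem : A ∈ S
  ne_zero : A ≠ 0
  rank_lt_aleph0 : (A : H →ₗ[ℂ] H).rank < Cardinal.aleph0
  rank_le : ∀ B ∈ S, B ≠ 0 → (A : H →ₗ[ℂ] H).rank ≤ (B : H →ₗ[ℂ] H).rank

/-- The self-adjoint projections of least nonzero rank in `S`. They index the summands in the
decomposition of `H`. -/
def minimalProjections [CompleteSpace H] (S : Subsemigroup (H →L[ℂ] H)) : Set (H →L[ℂ] H) :=
  {E | HasLeastRank S E ∧ IsStarProjection E}

variable {S : Subsemigroup (H →L[ℂ] H)} {A B E T : H →L[ℂ] H}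

/-- Otherwise the closed span of the orbit of `x` is a nontrivial invariant subspace, or the orbit
is zero and `x` itself spans one. -/
theorem exists_apply_ne_zero {F : Type*} [NormedAddCommGroup F] [NormedSpace ℂ F]
    (hirr : IsIrreducibleFamily (S : Set (H →L[ℂ] H))) (hS : ∃ A ∈ S, A ≠ 0)
    {C : H →L[ℂ] F} (hC : C ≠ 0) {x : H} (hx : x ≠ 0) : ∃ T ∈ S, C (T x) ≠ 0 := by
  by_contra! hCT
  let N : Submodule ℂ H := Submodule.span ℂ ((fun T : H →L[ℂ] H => T x) '' S)
  have hN (T : H →L[ℂ] H) (hT : T ∈ S) : T x ∈ N := Submodule.subset_span ⟨T, hT, rfl⟩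
  have hNinv (A : H →L[ℂ] H) (hA : A ∈ S) : N ≤ N.comap (A : H →ₗ[ℂ] H) := by
    rw [Submodule.span_le]
    rintro _ ⟨T, hT, rfl⟩
    exact hN (A * T) (S.mul_mem hA hT)
  rcases hirr N.topologicalClosure N.isClosed_topologicalClosure fun A hA y hy =>
    map_mem_closure A.continuous hy (hNinv A hA) with hbot | htop
  · have hzero (T : H →L[ℂ] H) (hT : T ∈ S) : T x = 0 := by
      simpa only [hbot, Submodule.mem_bot] using N.le_topologicalClosure (hN T hT)
    have hspan : Submodule.span ℂ {x} = ⊤ := by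
      refine (hirr _ (Submodule.closed_of_finiteDimensional _) fun T hT y hy => ?_).resolve_left
        (by rwa [Submodule.span_singleton_eq_bot])
      obtain ⟨c, rfl⟩ := Submodule.mem_span_singleton.1 hy
      simp only [map_smul, hzero T hT, smul_zero, Submodule.zero_mem]
    obtain ⟨A, hA, hA0⟩ := hS
    refine hA0 (ContinuousLinearMap.ext fun y => ?_)
    obtain ⟨c, rfl⟩ := Submodule.mem_span_singleton.1 (hspan ▸ Submodule.mem_top : y ∈ _)
    simp only [map_smul, hzero A hA, smul_zero, zero_apply]
  · have hker : N.topologicalClosure ≤ C.ker := by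
      refine N.topologicalClosure_minimal (Submodule.span_le.2 ?_) C.isClosed_ker
      rintro _ ⟨T, hT, rfl⟩
      exact hCT T hT
    exact hC (ContinuousLinearMap.ext fun y => hker (htop ▸ Submodule.mem_top))

theorem exists_mul_mul_ne_zero (hirr : IsIrreducibleFamily (S : Set (H →L[ℂ] H)))
    (hB : B ∈ S) (hA0 : A ≠ 0) (hB0 : B ≠ 0) : ∃ T ∈ S, A * T * B ≠ 0 := by
  obtain ⟨x, hx⟩ := DFunLike.ne_iff.1 hB0
  obtain ⟨T, hT, hATB⟩ := exists_apply_ne_zero hirr ⟨B, hB, hB0⟩ hA0 hx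
  exact ⟨T, hT, fun h => hATB (DFunLike.congr_fun h x)⟩

namespace HasLeastRank

theorem isLeast_nonzeroRanks (hA : HasLeastRank S A) :
    IsLeast (nonzeroRanks (S : Set (H →L[ℂ] H))) (A : H →ₗ[ℂ] H).rank :=
  ⟨⟨A, hA.mem, hA.ne_zero, rfl⟩, fun _ ⟨B, hB, hB0, hr⟩ => hr ▸ hA.rank_le B hB hB0⟩

theorem of_rank_le (hA : HasLeastRank S A) (hB : B ∈ S) (h0 : B ≠ 0)
    (h : (B : H →ₗ[ℂ] H).rank ≤ (A : H →ₗ[ℂ] H).rank) : HasLeastRank S B :=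
  ⟨hB, h0, h.trans_lt hA.rank_lt_aleph0, fun C hC hC0 => h.trans (hA.rank_le C hC hC0)⟩

theorem mul_left (hA : HasLeastRank S A) (hT : T ∈ S) (h : T * A ≠ 0) : HasLeastRank S (T * A) :=
  hA.of_rank_le (S.mul_mem hT hA.mem) h (rank_mul_le_right T A)

theorem mul_right (hA : HasLeastRank S A) (hT : T ∈ S) (h : A * T ≠ 0) : HasLeastRank S (A * T) :=
  hA.of_rank_le (S.mul_mem hA.mem hT) h (rank_mul_le_left A T)

end HasLeastRank

variable [CompleteSpace H]

theorem exists_hasLeastRank (hpi : ∀ A ∈ S, IsPartialIsometry A)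
    (hcompact : ∃ A ∈ S, A ≠ 0 ∧ IsCompactOperator A) : ∃ A, HasLeastRank S A := by
  obtain ⟨C, hC, hC0, hcomp⟩ := hcompact
  have hne : (nonzeroRanks (S : Set (H →L[ℂ] H))).Nonempty := ⟨_, C, hC, hC0, rfl⟩
  obtain ⟨A, hA, hA0, hrank⟩ := csInf_mem hne
  have hle (B : H →L[ℂ] H) (hB : B ∈ S) (hB0 : B ≠ 0) :
      (A : H →ₗ[ℂ] H).rank ≤ (B : H →ₗ[ℂ] H).rank :=
    hrank.trans_le (csInf_le' ⟨B, hB, hB0, rfl⟩)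
  exact ⟨A, hA, hA0,
    (hle C hC hC0).trans_lt ((hpi C hC).rank_lt_aleph0_of_isCompactOperator hcomp), hle⟩

/-- The operators on `K` which, transported to the range of `V` and extended by zero, belong
to `S`. -/
def cornerSemigroup {K : Type*} [NormedAddCommGroup K] [InnerProductSpace ℂ K] [CompleteSpace K]
    (S : Subsemigroup (H →L[ℂ] H)) (V : K →ₗᵢ[ℂ] H) : Subsemigroup (K →L[ℂ] K) where
  carrier := {C | block V V C ∈ S}
  mul_mem' {C D} hC hD := show block V V (C * D) ∈ S from
    block_mul_block V V V C D ▸ S.mul_mem hC hD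

theorem isClosed_cornerSemigroup {K : Type*} [NormedAddCommGroup K] [InnerProductSpace ℂ K]
    [CompleteSpace K] (hclosed : IsClosed (S : Set (H →L[ℂ] H))) (V : K →ₗᵢ[ℂ] H) :
    IsClosed (cornerSemigroup S V : Set (K →L[ℂ] K)) :=
  hclosed.preimage (continuous_block V V)

namespace HasLeastRank

theorem star_mul_self_mul_left (hA : HasLeastRank S A) (hpi : ∀ A ∈ S, IsPartialIsometry A)
    (hT : T ∈ S) (h : T * A ≠ 0) : star (T * A) * (T * A) = star A * A :=
  have hTA := hA.mul_left hT h
  (hpi A hA.mem).star_mul_self_eq_of_rank_le (hpi _ hTA.mem) hTA.rank_lt_aleph0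
    (hA.rank_le _ hTA.mem h) (by rw [mul_assoc, ← mul_assoc A, (hpi A hA.mem).mul_star_mul])

theorem self_mul_star_mul_right (hA : HasLeastRank S A) (hpi : ∀ A ∈ S, IsPartialIsometry A)
    (hT : T ∈ S) (h : A * T ≠ 0) : A * T * star (A * T) = A * star A :=
  have hAT := hA.mul_right hT h
  (hpi A hA.mem).self_mul_star_eq_of_rank_le (hpi _ hAT.mem) hAT.rank_lt_aleph0
    (hA.rank_le _ hAT.mem h) (by rw [← mul_assoc, (hpi A hA.mem).mul_star_mul])

theorem star_mul_self_eq_self_mul_star (hA : HasLeastRank S A) (hB : HasLeastRank S B)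
    (hpi : ∀ A ∈ S, IsPartialIsometry A) (h : B * A ≠ 0) : star B * B = A * star A :=
  have hBA := hA.mul_left hB.mem h
  (hpi A hA.mem).star_mul_self_eq_self_mul_star (hpi B hB.mem) (hpi _ hBA.mem) hA.rank_lt_aleph0
    (hB.rank_le A hA.mem hA.ne_zero) (hA.rank_le _ hBA.mem h)

/-- `B` acts as a unitary on the common initial and final space, which has finite dimension. -/
theorem star_mem_of_star_mul_self_eq (hB : HasLeastRank S B)
    (hpi : ∀ A ∈ S, IsPartialIsometry A) (hclosed : IsClosed (S : Set (H →L[ℂ] H)))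
    (h : star B * B = B * star B) : star B ∈ S := by
  have hpB := hpi B hB.mem
  obtain ⟨r, hr⟩ := Cardinal.lt_aleph0.1 hB.rank_lt_aleph0
  obtain ⟨V, hV⟩ := exists_block_one_eq hpB.self_mul_star (hpB.rank_self_mul_star.trans hr)
  set u := compress V V B
  have hu : block V V u = B := by
    rw [block_compress, hV, hpB.mul_star_mul, ← h, ← mul_assoc, hpB.mul_star_mul]
  have hunitary : u ∈ unitary _ := by
    constructor <;> apply block_injective V V
    · rw [← block_mul_block V V V, ← star_block, hu, h, hV]
    · rw [← block_mul_block V V V, ← star_block, hu, hV]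
  have := FiniteDimensional.proper ℂ (EuclideanSpace ℂ (Fin r) →L[ℂ] EuclideanSpace ℂ (Fin r))
  have hmem : block V V u ∈ S := hu.symm ▸ hB.mem
  rw [← hu, star_block]
  exact star_mem_of_mem_unitary (isClosed_cornerSemigroup hclosed V) hunitary hmem

/-- If `A T A ≠ 0` then `B := A T` is unitary on the final space of `A`, so `D := T B*` lies in `S`.
Since `A D = A A*`, the operators `A*` and `D` agree. -/
theorem star_mem (hA : HasLeastRank S A) (hpi : ∀ A ∈ S, IsPartialIsometry A)
    (hirr : IsIrreducibleFamily (S : Set (H →L[ℂ] H)))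
    (hclosed : IsClosed (S : Set (H →L[ℂ] H))) : star A ∈ S := by
  have hpA := hpi A hA.mem
  obtain ⟨T, hT, hATA⟩ := exists_mul_mul_ne_zero hirr hA.mem hA.ne_zero hA.ne_zero
  have hB : HasLeastRank S (A * T) := hA.mul_right hT (left_ne_zero_of_mul hATA)
  have hfinal : A * T * star (A * T) = A * star A := hA.self_mul_star_mul_right hpi hT hB.ne_zero
  have hBstar : star (A * T) ∈ S := hB.star_mem_of_star_mul_self_eq hpi hclosed
    ((hA.star_mul_self_eq_self_mul_star hB hpi hATA).trans hfinal.symm)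
  set D : H →L[ℂ] H := T * star (A * T)
  have hDmem : D ∈ S := S.mul_mem hT hBstar
  have hAD : A * D = A * star A := by rw [← hfinal, mul_assoc A T]
  have hADA : A * D * A ≠ 0 := by rw [hAD, hpA.mul_star_mul]; exact hA.ne_zero
  have hD : HasLeastRank S D := hA.of_rank_le hDmem
    (right_ne_zero_of_mul (left_ne_zero_of_mul hADA))
    ((rank_mul_le_right T _).trans ((hpi _ hB.mem).rank_star.trans_le (rank_mul_le_left A T)))
  have hinitial : star A * A = D * star D :=
    hD.star_mul_self_eq_self_mul_star hA hpi (left_ne_zero_of_mul hADA)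
  have hstar : star A = D :=
    calc star A = star A * A * star A := by simpa using hpA.star.mul_star_mul.symm
      _ = star A * A * D := by rw [mul_assoc, ← hAD, ← mul_assoc]
      _ = D := by rw [hinitial, (hpi D hDmem).mul_star_mul]
  exact hstar ▸ hDmem

theorem self_mul_star_mem_minimalProjections (hA : HasLeastRank S A)
    (hpi : ∀ A ∈ S, IsPartialIsometry A) (hirr : IsIrreducibleFamily (S : Set (H →L[ℂ] H)))
    (hclosed : IsClosed (S : Set (H →L[ℂ] H))) : A * star A ∈ minimalProjections S := by
  have hne : A * star A ≠ 0 := fun h => hA.ne_zero <| by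
    rw [← (hpi A hA.mem).mul_star_mul, h, zero_mul]
  exact ⟨hA.mul_right (hA.star_mem hpi hirr hclosed) hne, (hpi A hA.mem).self_mul_star⟩

theorem self_mul_star_eq_of_mul_ne_zero (hA : HasLeastRank S A) (hE : E ∈ minimalProjections S)
    (hpi : ∀ A ∈ S, IsPartialIsometry A) (h : E * A ≠ 0) : A * star A = E := by
  rw [← hA.star_mul_self_eq_self_mul_star hE.1 hpi h, hE.2.isSelfAdjoint.star_eq,
    hE.2.isIdempotentElem.eq]

theorem star_mul_self_eq_of_mul_ne_zero (hA : HasLeastRank S A) (hE : E ∈ minimalProjections S)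
    (hpi : ∀ A ∈ S, IsPartialIsometry A) (h : A * E ≠ 0) : star A * A = E := by
  rw [hE.1.star_mul_self_eq_self_mul_star hA hpi h, hE.2.isSelfAdjoint.star_eq,
    hE.2.isIdempotentElem.eq]

end HasLeastRank

end LeastRank

section MinimalProjections

variable {H : Type*} [NormedAddCommGroup H] [InnerProductSpace ℂ H] [CompleteSpace H]
  {S : Subsemigroup (H →L[ℂ] H)} {E F P T : H →L[ℂ] H}

theorem nonempty_minimalProjections (hpi : ∀ A ∈ S, IsPartialIsometry A)
    (hirr : IsIrreducibleFamily (S : Set (H →L[ℂ] H))) (hclosed : IsClosed (S : Set (H →L[ℂ] H)))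
    (hcompact : ∃ A ∈ S, A ≠ 0 ∧ IsCompactOperator A) : (minimalProjections S).Nonempty :=
  have ⟨A, hA⟩ := exists_hasLeastRank hpi hcompact
  ⟨A * star A, hA.self_mul_star_mem_minimalProjections hpi hirr hclosed⟩

theorem mul_eq_zero_of_mem_minimalProjections (hpi : ∀ A ∈ S, IsPartialIsometry A)
    (hE : E ∈ minimalProjections S) (hF : F ∈ minimalProjections S) (hne : E ≠ F) :
    E * F = 0 := by
  contrapose! hne
  rw [← hF.1.self_mul_star_eq_of_mul_ne_zero hE hpi hne, hF.2.isSelfAdjoint.star_eq,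
    hF.2.isIdempotentElem.eq]

theorem subsingleton_minimalProjections (hpi : ∀ A ∈ S, IsPartialIsometry A) (h0 : 0 ∉ S) :
    (minimalProjections S).Subsingleton := by
  intro E hE F hF
  contrapose! h0
  exact mul_eq_zero_of_mem_minimalProjections hpi hE hF h0 ▸ S.mul_mem hE.1.mem hF.1.mem

theorem eq_of_mul_mul_ne_zero_left (hpi : ∀ A ∈ S, IsPartialIsometry A) (hT : T ∈ S)
    (hE : E ∈ minimalProjections S) (hF : F ∈ minimalProjections S) (hP : P ∈ minimalProjections S)
    (hEP : E * T * P ≠ 0) (hFP : F * T * P ≠ 0) : E = F := by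
  rw [mul_assoc] at hEP hFP
  have hTP : HasLeastRank S (T * P) := hP.1.mul_left hT (right_ne_zero_of_mul hEP)
  rw [← hTP.self_mul_star_eq_of_mul_ne_zero hE hpi hEP,
    hTP.self_mul_star_eq_of_mul_ne_zero hF hpi hFP]

theorem eq_of_mul_mul_ne_zero_right (hpi : ∀ A ∈ S, IsPartialIsometry A) (hT : T ∈ S)
    (hE : E ∈ minimalProjections S) (hF : F ∈ minimalProjections S) (hP : P ∈ minimalProjections S)
    (hPE : P * T * E ≠ 0) (hPF : P * T * F ≠ 0) : E = F := by
  have hPT : HasLeastRank S (P * T) := hP.1.mul_right hT (left_ne_zero_of_mul hPE)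
  rw [← hPT.star_mul_self_eq_of_mul_ne_zero hE hpi hPE,
    hPT.star_mul_self_eq_of_mul_ne_zero hF hpi hPF]

theorem exists_mem_of_mem_minimalProjections (hpi : ∀ A ∈ S, IsPartialIsometry A)
    (hirr : IsIrreducibleFamily (S : Set (H →L[ℂ] H)))
    (hE : E ∈ minimalProjections S) (hF : F ∈ minimalProjections S) :
    ∃ A, HasLeastRank S A ∧ star A * A = E ∧ A * star A = F := by
  obtain ⟨T, hT, hne⟩ := exists_mul_mul_ne_zero hirr hE.1.mem hF.1.ne_zero hE.1.ne_zero
  refine ⟨F * T * E, hE.1.mul_left (S.mul_mem hF.1.mem hT) hne, ?_, ?_⟩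
  · rw [hE.1.star_mul_self_mul_left hpi (S.mul_mem hF.1.mem hT) hne, hE.2.isSelfAdjoint.star_eq,
      hE.2.isIdempotentElem.eq]
  · rw [mul_assoc F T E] at hne ⊢
    rw [hF.1.self_mul_star_mul_right hpi (S.mul_mem hT hE.1.mem) hne, hF.2.isSelfAdjoint.star_eq,
      hF.2.isIdempotentElem.eq]

/-- The span is invariant, because `T E = (T E) (T E)* (T E)` and `(T E) (T E)*` is a minimal
projection for every minimal projection `E` and every `T ∈ S` with `T E ≠ 0`. -/
theorem topologicalClosure_iSup_range_minimalProjections (hpi : ∀ A ∈ S, IsPartialIsometry A)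
    (hirr : IsIrreducibleFamily (S : Set (H →L[ℂ] H))) (hclosed : IsClosed (S : Set (H →L[ℂ] H)))
    (hcompact : ∃ A ∈ S, A ≠ 0 ∧ IsCompactOperator A) :
    (⨆ E : minimalProjections S, E.1.range).topologicalClosure = ⊤ := by
  set N : Submodule ℂ H := ⨆ E : minimalProjections S, E.1.range
  have hmem {E : H →L[ℂ] H} (hE : E ∈ minimalProjections S) (x : H) : E x ∈ N :=
    Submodule.mem_iSup_of_mem ⟨E, hE⟩ ⟨x, rfl⟩
  have hinv (T : H →L[ℂ] H) (hT : T ∈ S) : N ≤ N.comap (T : H →ₗ[ℂ] H) := by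
    refine iSup_le ?_
    rintro ⟨E, hE⟩ _ ⟨x, rfl⟩
    change (T * E) x ∈ N
    by_cases hTE : T * E = 0
    · simp only [hTE, zero_apply, N.zero_mem]
    · have hA : HasLeastRank S (T * E) := hE.1.mul_left hT hTE
      rw [← (hpi _ hA.mem).mul_star_mul]
      exact hmem (hA.self_mul_star_mem_minimalProjections hpi hirr hclosed) _
  refine (hirr N.topologicalClosure N.isClosed_topologicalClosure fun T hT x hx =>
    map_mem_closure T.continuous hx (hinv T hT)).resolve_left fun hbot => ?_
  obtain ⟨E, hE⟩ := nonempty_minimalProjections hpi hirr hclosed hcompact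
  refine hE.1.ne_zero (ContinuousLinearMap.ext fun x => ?_)
  simpa only [hbot, Submodule.mem_bot, zero_apply] using N.le_topologicalClosure (hmem hE x)

/-- The sets `{x | ‖x - E x‖ < ‖E x‖}` are open and pairwise disjoint. -/
theorem countable_of_pairwise_mul_eq_zero [TopologicalSpace.SeparableSpace H]
    {𝓔 : Set (H →L[ℂ] H)} (hproj : ∀ E ∈ 𝓔, IsStarProjection E) (hne : ∀ E ∈ 𝓔, E ≠ 0)
    (horth : 𝓔.Pairwise fun E F => E * F = 0) : 𝓔.Countable := by
  let O (E : H →L[ℂ] H) : Set H := {x | ‖x - E x‖ < ‖E x‖}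
  have hdisj : 𝓔.PairwiseDisjoint O := by
    intro E hE F hF hEF
    refine Set.disjoint_left.2 fun x (hxE : ‖x - E x‖ < ‖E x‖) (hxF : ‖x - F x‖ < ‖F x‖) => ?_
    have hle {E F : H →L[ℂ] H} (hE : IsStarProjection E) (h : E * F = 0) : ‖E x‖ ≤ ‖x - F x‖ :=
      calc ‖E x‖ = ‖E (x - F x)‖ := by
            rw [map_sub, show E (F x) = 0 from DFunLike.congr_fun h x, sub_zero]
        _ ≤ 1 * ‖x - F x‖ := E.le_of_opNorm_le hE.norm_le _
        _ = ‖x - F x‖ := one_mul _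
    linarith [hle (hproj E hE) (horth hE hF hEF), hle (hproj F hF) (horth hF hE hEF.symm)]
  refine hdisj.countable_of_isOpen (fun E _ => ?_) fun E hE => ?_
  · exact isOpen_lt (continuous_id.sub E.continuous).norm E.continuous.norm
  · obtain ⟨x, hx⟩ := DFunLike.ne_iff.1 (hne E hE)
    refine ⟨E x, ?_⟩
    have hEE : E (E x) = E x := DFunLike.congr_fun (hproj E hE).isIdempotentElem x
    simpa [O, hEE] using hx

theorem exists_index_equiv (ι : Type*) [Countable ι] [Nonempty ι] :
    ∃ k : ℕ∞, 1 ≤ k ∧ Nonempty (Index k ≃ ι) := by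
  rcases finite_or_infinite ι with _ | _
  · refine ⟨Nat.card ι, by exact_mod_cast Nat.card_pos, ⟨?_⟩⟩
    exact (Equiv.subtypeEquivRight fun i => Nat.cast_lt).trans
      (Fin.equivSubtype.symm.trans (Finite.equivFin ι).symm)
  · obtain ⟨_⟩ := nonempty_denumerable ι
    exact ⟨⊤, le_top, ⟨(Equiv.subtypeUnivEquiv fun i => ENat.natCast_lt_top i).trans
      (Denumerable.eqv ι).symm⟩⟩

theorem eq_one_of_subsingleton_index {k : ℕ∞} (hk : 1 ≤ k) (h : Subsingleton (Index k)) :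
    k = 1 := by
  by_contra hne
  have h1 : (1 : ℕ∞) < k := lt_of_le_of_ne hk (Ne.symm hne)
  have := congrArg Subtype.val
    (h.elim ⟨0, zero_lt_one.trans_le hk⟩ ⟨1, by exact_mod_cast h1⟩)
  exact zero_ne_one this

theorem exists_index_equiv_minimalProjections [TopologicalSpace.SeparableSpace H]
    (hpi : ∀ A ∈ S, IsPartialIsometry A) (hirr : IsIrreducibleFamily (S : Set (H →L[ℂ] H)))
    (hclosed : IsClosed (S : Set (H →L[ℂ] H)))
    (hcompact : ∃ A ∈ S, A ≠ 0 ∧ IsCompactOperator A) :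
    ∃ k : ℕ∞, 1 ≤ k ∧ Nonempty (Index k ≃ minimalProjections S) := by
  have : Countable (minimalProjections S) :=
    (countable_of_pairwise_mul_eq_zero (fun E hE => hE.2) (fun E hE => hE.1.ne_zero)
      fun E hE F hF => mul_eq_zero_of_mem_minimalProjections hpi hE hF).to_subtype
  have : Nonempty (minimalProjections S) :=
    (nonempty_minimalProjections hpi hirr hclosed hcompact).to_subtype
  exact exists_index_equiv (minimalProjections S)

end MinimalProjections

section CornerSemigroup

theorem exists_subgroup_unitaryOperators_eq {r : ℕ}
    {T : Subsemigroup (EuclideanSpace ℂ (Fin r) →L[ℂ] EuclideanSpace ℂ (Fin r))}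
    (hT : IsClosed (T : Set (EuclideanSpace ℂ (Fin r) →L[ℂ] EuclideanSpace ℂ (Fin r))))
    (hone : 1 ∈ T) :
    ∃ U : Subgroup (Matrix.unitaryGroup (Fin r) ℂ),
      unitaryOperators U = {C | C ∈ unitary _ ∧ C ∈ T} := by
  have := FiniteDimensional.proper ℂ (EuclideanSpace ℂ (Fin r) →L[ℂ] EuclideanSpace ℂ (Fin r))
  let Φ := Matrix.toEuclideanCLM (n := Fin r) (𝕜 := ℂ)
  let U : Subgroup (Matrix.unitaryGroup (Fin r) ℂ) :=
    { carrier := {u | Φ u ∈ T}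
      mul_mem' := fun {u v} hu hv => by
        change Φ (u * v : Matrix (Fin r) (Fin r) ℂ) ∈ T
        rw [map_mul]
        exact T.mul_mem hu hv
      one_mem' := by
        change Φ 1 ∈ T
        rwa [map_one]
      inv_mem' := fun {u} hu => by
        change Φ (star (u : Matrix (Fin r) (Fin r) ℂ)) ∈ T
        rw [map_star]
        exact star_mem_of_mem_unitary hT (Unitary.map_mem Φ u.2) hu }
  refine ⟨U, Set.ext fun C => ⟨?_, fun ⟨hC, hCT⟩ => ?_⟩⟩
  · rintro ⟨u, hu, rfl⟩
    exact ⟨Unitary.map_mem Φ u.2, hu⟩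
  · have hΦ : Φ (Φ.symm C) = C := Φ.apply_symm_apply C
    exact ⟨⟨Φ.symm C, Unitary.map_mem Φ.symm hC⟩, show Φ (Φ.symm C) ∈ T from hΦ.symm ▸ hCT, hΦ⟩

variable {H K : Type*} [NormedAddCommGroup H] [InnerProductSpace ℂ H] [CompleteSpace H]
  [NormedAddCommGroup K] [InnerProductSpace ℂ K] [CompleteSpace K]
  {S : Subsemigroup (H →L[ℂ] H)} {V : K →ₗᵢ[ℂ] H} {C : K →L[ℂ] K}

theorem mem_unitary_of_mem_cornerSemigroup (hpi : ∀ A ∈ S, IsPartialIsometry A)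
    (hV : block V V 1 ∈ minimalProjections S) (hC : C ∈ cornerSemigroup S V) (hC0 : C ≠ 0) :
    C ∈ unitary (K →L[ℂ] K) := by
  have hCV : block V V C * block V V 1 = block V V C := by rw [block_mul_block, mul_one]
  have hVC : block V V 1 * block V V C = block V V C := by rw [block_mul_block, one_mul]
  have hne : block V V C ≠ 0 := block_ne_zero V V hC0
  have hrank : HasLeastRank S (block V V C) :=
    hVC ▸ hV.1.mul_right (show block V V C ∈ S from hC) (hVC.symm ▸ hne)
  constructor <;> apply block_injective V V
  · rw [← block_mul_block V V V, ← star_block,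
      hrank.star_mul_self_eq_of_mul_ne_zero hV hpi (hCV.symm ▸ hne)]
  · rw [← block_mul_block V V V, ← star_block,
      hrank.self_mul_star_eq_of_mul_ne_zero hV hpi (hVC.symm ▸ hne)]

theorem isIrreducibleFamily_of_cornerSemigroup_subset
    (hirr : IsIrreducibleFamily (S : Set (H →L[ℂ] H))) (hV : block V V 1 ∈ S)
    {𝓤 : Set (K →L[ℂ] K)} (h𝓤 : ∀ C ∈ cornerSemigroup S V, C ≠ 0 → C ∈ 𝓤) :
    IsIrreducibleFamily 𝓤 := by
  intro M hM hinv
  have : CompleteSpace M := hM.completeSpace_coe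
  by_contra! hM'
  obtain ⟨x, hx, hx0⟩ := M.ne_bot_iff.1 hM'.1
  obtain ⟨y, hy, hy0⟩ := Mᗮ.ne_bot_iff.1 (mt Submodule.orthogonal_eq_bot_iff.1 hM'.2)
  have hV0 {z : K} (hz : z ≠ 0) : V z ≠ 0 := (map_ne_zero_iff V V.injective).2 hz
  have hVone : block V V 1 ≠ 0 := block_ne_zero V V fun h => hx0 (DFunLike.congr_fun h x)
  have hfun : innerSL ℂ (V y) ≠ 0 := fun h =>
    inner_self_ne_zero.2 (hV0 hy0) (DFunLike.congr_fun h (V y))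
  obtain ⟨T, hT, hyTx⟩ := exists_apply_ne_zero hirr ⟨_, hV, hVone⟩ hfun (hV0 hx0)
  have hcompress : inner ℂ y (compress V V T x) ≠ 0 := by
    rwa [compress, ContinuousLinearMap.comp_apply, ContinuousLinearMap.adjoint_inner_right]
  have hmem : compress V V T ∈ cornerSemigroup S V :=
    show block V V (compress V V T) ∈ S from
      block_compress V V T ▸ S.mul_mem (S.mul_mem hV hT) hV
  have hne : compress V V T ≠ 0 := fun h => hcompress (by rw [h, zero_apply, inner_zero_right])
  exact hcompress (Submodule.inner_left_of_mem_orthogonal (hinv _ (h𝓤 _ hmem hne) x hx) hy)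

end CornerSemigroup

section MatrixUnitFrame

variable {ι H K : Type*} [NormedAddCommGroup H] [InnerProductSpace ℂ H] [CompleteSpace H]
  [NormedAddCommGroup K] [InnerProductSpace ℂ K] [CompleteSpace K]
  {S : Subsemigroup (H →L[ℂ] H)} {e : ι ≃ minimalProjections S} {V : ι → K →ₗᵢ[ℂ] H}
  {T : H →L[ℂ] H} {C : K →L[ℂ] K} {i j : ι}

/-- Parametrizations `V i` of the ranges of the minimal projections by one Hilbert space `K`, such
that the matrix units `V i (V j)*` lie in `S`. -/
structure IsMatrixUnitFrame (e : ι ≃ minimalProjections S) (V : ι → K →ₗᵢ[ℂ] H) : Prop where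
  block_one_eq : ∀ i, block (V i) (V i) 1 = e i
  block_one_mem : ∀ i j, block (V i) (V j) 1 ∈ S

theorem exists_isMatrixUnitFrame (hpi : ∀ A ∈ S, IsPartialIsometry A)
    (hirr : IsIrreducibleFamily (S : Set (H →L[ℂ] H))) (hclosed : IsClosed (S : Set (H →L[ℂ] H)))
    (e : ι ≃ minimalProjections S) {V₀ : K →ₗᵢ[ℂ] H}
    (hV₀ : block V₀ V₀ 1 ∈ minimalProjections S) :
    ∃ V : ι → K →ₗᵢ[ℂ] H, IsMatrixUnitFrame e V := by
  choose A hA hinitial hfinal using fun i =>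
    exists_mem_of_mem_minimalProjections hpi hirr hV₀ (e i).2
  have hAV₀ (i : ι) : A i * block V₀ V₀ 1 = A i := by
    rw [← hinitial i, ← mul_assoc, (hpi _ (hA i).mem).mul_star_mul]
  let J (i : ι) : K →L[ℂ] H := A i ∘L V₀.toContinuousLinearMap
  have hJ (i : ι) : (J i)† ∘L J i = 1 :=
    calc (J i)† ∘L J i = compress V₀ V₀ (star (A i) * A i) := by
          simp only [J, ContinuousLinearMap.adjoint_comp]; rfl
      _ = 1 := by rw [hinitial, compress_block]
  let V (i : ι) : K →ₗᵢ[ℂ] H :=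
    ⟨J i, (ContinuousLinearMap.norm_map_iff_adjoint_comp_self (J i)).2 (hJ i)⟩
  have hunit (i j : ι) : block (V i) (V j) 1 = A i * star (A j) :=
    calc block (V i) (V j) 1 = J i ∘L (J j)† := rfl
      _ = A i * block V₀ V₀ 1 * star (A j) := by
        simp only [J, ContinuousLinearMap.adjoint_comp]; rfl
      _ = A i * star (A j) := by rw [hAV₀]
  exact ⟨V, fun i => (hunit i i).trans (hfinal i), fun i j =>
    hunit i j ▸ S.mul_mem (hA i).mem ((hA j).star_mem hpi hirr hclosed)⟩

namespace IsMatrixUnitFrame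

theorem block_mem (hV : IsMatrixUnitFrame e V) (h : block (V i) (V j) C ∈ S) (i' j' : ι) :
    block (V i') (V j') C ∈ S := by
  simpa only [block_mul_block, one_mul, mul_one] using
    S.mul_mem (S.mul_mem (hV.block_one_mem i' i) h) (hV.block_one_mem j j')

theorem block_compress_mem (hV : IsMatrixUnitFrame e V) (hT : T ∈ S) (i j : ι) :
    block (V i) (V j) (compress (V i) (V j) T) ∈ S := by
  rw [block_compress]
  exact S.mul_mem (S.mul_mem (hV.block_one_mem i i) hT) (hV.block_one_mem j j)

theorem mul_mul_ne_zero (hV : IsMatrixUnitFrame e V) (h : compress (V i) (V j) T ≠ 0) :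
    (e i : H →L[ℂ] H) * T * (e j : H →L[ℂ] H) ≠ 0 := by
  rw [← hV.block_one_eq i, ← hV.block_one_eq j, ← block_compress]
  exact block_ne_zero _ _ h

theorem exists_mem_pattern₁ (hV : IsMatrixUnitFrame e V) (hpi : ∀ A ∈ S, IsPartialIsometry A)
    (hT : T ∈ S) : ∃ M ∈ pattern₁ ι, ∀ i j, M i j = 0 ↔ compress (V i) (V j) T = 0 := by
  classical
  let M : Matrix ι ι ℂ := fun i j => if compress (V i) (V j) T = 0 then 0 else 1
  have hM (i j : ι) : M i j = 0 ↔ compress (V i) (V j) T = 0 := by simp [M]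
  have hM1 (i j : ι) (h : M i j ≠ 0) : M i j = 1 := if_neg (mt (hM i j).2 h)
  have hne {i j : ι} (h : M i j ≠ 0) : (e i : H →L[ℂ] H) * T * (e j : H →L[ℂ] H) ≠ 0 :=
    hV.mul_mul_ne_zero (mt (hM i j).2 h)
  refine ⟨M, ⟨hM1, fun i j j' h h' => ?_, fun i i' j h h' => ?_⟩, hM⟩ <;>
    refine e.injective (Subtype.ext ?_)
  · exact eq_of_mul_mul_ne_zero_right hpi hT (e j).2 (e j').2 (e i).2 (hne h) (hne h')
  · exact eq_of_mul_mul_ne_zero_left hpi hT (e i).2 (e i').2 (e j).2 (hne h) (hne h')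

theorem orthogonalFamily (hV : IsMatrixUnitFrame e V) (hpi : ∀ A ∈ S, IsPartialIsometry A) :
    OrthogonalFamily ℂ (fun _ : ι => K) V := by
  intro i j hij x y
  have horth : block (V i) (V i) 1 * block (V j) (V j) 1 = 0 := by
    rw [hV.block_one_eq, hV.block_one_eq]
    exact mul_eq_zero_of_mem_minimalProjections hpi (e i).2 (e j).2
      (Subtype.val_injective.ne (e.injective.ne hij))
  have hfix (k : ι) (z : K) : block (V k) (V k) 1 (V k z) = V k z :=
    congrArg (V k) (adjoint_apply_self (V k) z)
  have hstar : (block (V i) (V i) 1)† = block (V i) (V i) 1 :=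
    (isStarProjection_block_one (V i)).isSelfAdjoint.star_eq
  calc inner ℂ (V i x) (V j y)
      = inner ℂ (V i x) ((block (V i) (V i) 1 * block (V j) (V j) 1) (V j y)) := by
        rw [mul_apply_eq_comp, hfix, ← hstar,
          ContinuousLinearMap.adjoint_inner_right, hfix]
    _ = 0 := by rw [horth, zero_apply, inner_zero_right]

theorem isHilbertSum (hV : IsMatrixUnitFrame e V) (hpi : ∀ A ∈ S, IsPartialIsometry A)
    (hirr : IsIrreducibleFamily (S : Set (H →L[ℂ] H))) (hclosed : IsClosed (S : Set (H →L[ℂ] H)))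
    (hcompact : ∃ A ∈ S, A ≠ 0 ∧ IsCompactOperator A) : IsHilbertSum ℂ (fun _ : ι => K) V := by
  refine IsHilbertSum.mk (hV.orthogonalFamily hpi) (Eq.ge ?_)
  rw [← topologicalClosure_iSup_range_minimalProjections hpi hirr hclosed hcompact,
    ← e.iSup_comp (g := fun E : minimalProjections S => E.1.range)]
  simp only [← hV.block_one_eq, range_block_one]

end IsMatrixUnitFrame

end MatrixUnitFrame

section OperatorMatrix

variable {ι K : Type*} [DecidableEq ι] [NormedAddCommGroup K] [InnerProductSpace ℂ K]

theorem eq_of_isOperatorMatrix {B : Matrix ι ι (K →L[ℂ] K)}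
    {T T' : DirectSumSpace ι K →L[ℂ] DirectSumSpace ι K} (h : IsOperatorMatrix B T)
    (h' : IsOperatorMatrix B T') : T = T' := by
  refine lp.ext_continuousLinearMap ENNReal.ofNat_ne_top fun j => ?_
  ext x i
  exact (h i j x).trans (h' i j x).symm

theorem exists_isOperatorMatrix_ite_of_mem_inflate {T : DirectSumSpace ι K →L[ℂ] DirectSumSpace ι K}
    {𝓤 : Set (K →L[ℂ] K)} (hT : T ∈ inflate (pattern₀ ι) 𝓤) (hT0 : T ≠ 0) :
    ∃ i j, ∃ C ∈ 𝓤, IsOperatorMatrix (fun i' j' => if i' = i ∧ j' = j then C else 0) T := by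
  obtain ⟨B, hB, M, hM, hBM⟩ := hT
  obtain ⟨i, j, hij⟩ : ∃ i j, M i j ≠ 0 := by
    contrapose! hT0
    refine eq_of_isOperatorMatrix hB fun i j x => ?_
    rw [(hBM i j).1 (hT0 i j)]
    rfl
  refine ⟨i, j, B i j, (hBM i j).2 hij, ?_⟩
  suffices h : B = fun i' j' => if i' = i ∧ j' = j then B i j else 0 from h ▸ hB
  ext1 i' j'
  split_ifs with h
  · rw [h.1, h.2]
  · exact (hBM i' j').1 (not_not.1 fun h' => h (hM.2 _ _ _ _ h' hij))

end OperatorMatrix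

section HilbertSum

variable {ι H K : Type*} [NormedAddCommGroup H] [InnerProductSpace ℂ H] [CompleteSpace H]
  [NormedAddCommGroup K] [InnerProductSpace ℂ K] [CompleteSpace K] {V : ι → K →ₗᵢ[ℂ] H}

theorem linearIsometryEquiv_apply (hV : IsHilbertSum ℂ (fun _ : ι => K) V) (y : H) (i : ι) :
    hV.linearIsometryEquiv y i = ((V i).toContinuousLinearMap†) y := by
  classical
  refine ext_inner_left ℂ fun x => ?_
  rw [ContinuousLinearMap.adjoint_inner_right, LinearIsometry.coe_toContinuousLinearMap,
    ← hV.linearIsometryEquiv_symm_apply_single, ← lp.inner_single_left (𝕜 := ℂ)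
    (G := fun _ : ι => K), ← LinearIsometryEquiv.inner_map_map hV.linearIsometryEquiv
      (hV.linearIsometryEquiv.symm _), LinearIsometryEquiv.apply_symm_apply]

theorem isOperatorMatrix_conjStarAlgEquiv [DecidableEq ι]
    (hV : IsHilbertSum ℂ (fun _ : ι => K) V) (T : H →L[ℂ] H) :
    IsOperatorMatrix (fun i j => compress (V i) (V j) T)
      (hV.linearIsometryEquiv.conjStarAlgEquiv T) := by
  intro i j x
  rw [LinearIsometryEquiv.conjStarAlgEquiv_apply_apply,
    hV.linearIsometryEquiv_symm_apply_single, linearIsometryEquiv_apply]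
  rfl

end HilbertSum

section Embedding

variable {ι H K : Type*} [DecidableEq ι] [NormedAddCommGroup H] [InnerProductSpace ℂ H]
  [CompleteSpace H] [NormedAddCommGroup K] [InnerProductSpace ℂ K] [CompleteSpace K]
  {S : Subsemigroup (H →L[ℂ] H)} {e : ι ≃ minimalProjections S} {V : ι → K →ₗᵢ[ℂ] H}
  {𝓤 : Set (K →L[ℂ] K)}

theorem adjoint_comp_eq_ite (hV : OrthogonalFamily ℂ (fun _ : ι => K) V) (i j : ι) :
    (V i).toContinuousLinearMap† ∘L (V j).toContinuousLinearMap = if i = j then 1 else 0 := by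
  ext x
  refine ext_inner_left ℂ fun y => ?_
  rw [ContinuousLinearMap.comp_apply, ContinuousLinearMap.adjoint_inner_right]
  split_ifs with h
  · subst h
    exact (V i).inner_map_map y x
  · rw [zero_apply, inner_zero_right]
    exact hV h y x

theorem compress_block_eq_ite (hV : OrthogonalFamily ℂ (fun _ : ι => K) V) (C : K →L[ℂ] K)
    (i j i' j' : ι) : compress (V i') (V j') (block (V i) (V j) C) =
      if i' = i ∧ j' = j then C else 0 :=
  calc compress (V i') (V j') (block (V i) (V j) C)
      = ((V i').toContinuousLinearMap† ∘L (V i).toContinuousLinearMap) ∘L C ∘L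
          ((V j).toContinuousLinearMap† ∘L (V j').toContinuousLinearMap) := rfl
    _ = if i' = i ∧ j' = j then C else 0 := by
      rw [adjoint_comp_eq_ite hV, adjoint_comp_eq_ite hV, ite_and]
      split_ifs <;> simp_all [ContinuousLinearMap.one_def]

namespace IsMatrixUnitFrame

theorem inflate_pattern₀_diff_subset (hV : IsMatrixUnitFrame e V)
    (hsum : IsHilbertSum ℂ (fun _ : ι => K) V) {i₀ : ι}
    (h𝓤 : 𝓤 ⊆ cornerSemigroup S (V i₀)) :
    inflate (pattern₀ ι) 𝓤 \ {0} ⊆ conjugate hsum.linearIsometryEquiv S := by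
  rintro T ⟨hT, hT0⟩
  obtain ⟨i, j, C, hC, hTC⟩ := exists_isOperatorMatrix_ite_of_mem_inflate hT hT0
  refine ⟨block (V i) (V j) C, hV.block_mem (h𝓤 hC) i j, eq_of_isOperatorMatrix ?_ hTC⟩
  simpa only [compress_block_eq_ite hsum.OrthogonalFamily] using
    isOperatorMatrix_conjStarAlgEquiv hsum (block (V i) (V j) C)

theorem conjugate_subset_inflate_pattern₁ (hV : IsMatrixUnitFrame e V)
    (hpi : ∀ A ∈ S, IsPartialIsometry A) (hsum : IsHilbertSum ℂ (fun _ : ι => K) V) {i₀ : ι}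
    (h𝓤 : ∀ C ∈ cornerSemigroup S (V i₀), C ≠ 0 → C ∈ 𝓤) :
    conjugate hsum.linearIsometryEquiv S ⊆ inflate (pattern₁ ι) 𝓤 := by
  rintro _ ⟨T, hT, rfl⟩
  obtain ⟨M, hM, hMT⟩ := hV.exists_mem_pattern₁ hpi hT
  exact ⟨_, isOperatorMatrix_conjStarAlgEquiv hsum T, M, hM, fun i j => ⟨(hMT i j).1, fun h =>
    h𝓤 _ (hV.block_mem (hV.block_compress_mem hT i j) i₀ i₀) (mt (hMT i j).2 h)⟩⟩

end IsMatrixUnitFrame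

end Embedding

end PartialIsometrySemigroup

open PartialIsometrySemigroup in
theorem theorem3p13_general {H : Type*} [NormedAddCommGroup H] [InnerProductSpace ℂ H]
    [CompleteSpace H] (S : Subsemigroup (H →L[ℂ] H))
    (hpi : ∀ A ∈ S, IsPartialIsometry A)
    (hirr : IsIrreducibleFamily (S : Set (H →L[ℂ] H)))
    (hclosed : IsClosed (S : Set (H →L[ℂ] H)))
    (hcompact : ∃ A ∈ S, A ≠ 0 ∧ IsCompactOperator A)
    {ι : Type*} [DecidableEq ι] (e : ι ≃ minimalProjections S) :
    ∃ (r₀ : ℕ) (U : Subgroup (Matrix.unitaryGroup (Fin r₀) ℂ))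
      (W : H ≃ₗᵢ[ℂ] DirectSumSpace ι (EuclideanSpace ℂ (Fin r₀))),
      IsLeast (nonzeroRanks (S : Set (H →L[ℂ] H))) (r₀ : Cardinal) ∧
      IsIrreducibleFamily (unitaryOperators U) ∧
      inflate (pattern₀ ι) (unitaryOperators U) \ {0} ⊆ conjugate W (S : Set (H →L[ℂ] H)) ∧
      (¬ (Subsingleton ι ∧ (0 : H →L[ℂ] H) ∉ S) →
        inflate (pattern₀ ι) (unitaryOperators U) ⊆ conjugate W (S : Set (H →L[ℂ] H))) ∧
      conjugate W (S : Set (H →L[ℂ] H)) ⊆ inflate (pattern₁ ι) (unitaryOperators U) := by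
  obtain ⟨E, hE⟩ := nonempty_minimalProjections hpi hirr hclosed hcompact
  have i₀ : ι := e.symm ⟨E, hE⟩
  obtain ⟨r₀, hr₀⟩ := Cardinal.lt_aleph0.1 hE.1.rank_lt_aleph0
  obtain ⟨V₀, hV₀⟩ := exists_block_one_eq hE.2 hr₀
  obtain ⟨V, hV⟩ := exists_isMatrixUnitFrame hpi hirr hclosed e (hV₀ ▸ hE)
  have hVi₀ : block (V i₀) (V i₀) 1 ∈ minimalProjections S := hV.block_one_eq i₀ ▸ (e i₀).2
  obtain ⟨U, hU⟩ := exists_subgroup_unitaryOperators_eq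
    (isClosed_cornerSemigroup hclosed (V i₀)) (show block (V i₀) (V i₀) 1 ∈ S from hVi₀.1.mem)
  have hcorner (C) (hC : C ∈ cornerSemigroup S (V i₀)) (hC0 : C ≠ 0) : C ∈ unitaryOperators U :=
    hU.symm ▸ ⟨mem_unitary_of_mem_cornerSemigroup hpi hVi₀ hC hC0, hC⟩
  have hsum := hV.isHilbertSum hpi hirr hclosed hcompact
  have hS₀ := hV.inflate_pattern₀_diff_subset hsum (hU.le.trans fun C hC => hC.2)
  refine ⟨r₀, U, hsum.linearIsometryEquiv, hr₀ ▸ hE.1.isLeast_nonzeroRanks,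
    isIrreducibleFamily_of_cornerSemigroup_subset hirr hVi₀.1.mem hcorner, hS₀,
    fun hexc T hT => ?_, hV.conjugate_subset_inflate_pattern₁ hpi hsum hcorner⟩
  rcases eq_or_ne T 0 with rfl | hT0
  · have hzero : (0 : H →L[ℂ] H) ∈ S := by
      by_contra h0
      have := (subsingleton_minimalProjections hpi h0).coe_sort
      exact hexc ⟨e.subsingleton, h0⟩
    exact ⟨0, hzero, map_zero _⟩
  · exact hS₀ ⟨hT, hT0⟩

open PartialIsometrySemigroup in
theorem theorem3p13 {H : Type*} [NormedAddCommGroup H] [InnerProductSpace ℂ H] [CompleteSpace H]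
    [TopologicalSpace.SeparableSpace H]
    (S : Subsemigroup (H →L[ℂ] H))
    (hpi : ∀ A ∈ S, IsPartialIsometry A)
    (hirr : IsIrreducibleFamily (S : Set (H →L[ℂ] H)))
    (hclosed : IsClosed (S : Set (H →L[ℂ] H)))
    (hcompact : ∃ A ∈ S, A ≠ 0 ∧ IsCompactOperator A) :
    ∃ (k : ℕ∞) (r₀ : ℕ) (U : Subgroup (Matrix.unitaryGroup (Fin r₀) ℂ))
      (W : H ≃ₗᵢ[ℂ] DirectSumSpace (Index k) (EuclideanSpace ℂ (Fin r₀))),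
      1 ≤ k ∧
      IsLeast (nonzeroRanks (S : Set (H →L[ℂ] H))) (r₀ : Cardinal) ∧
      IsIrreducibleFamily (unitaryOperators U) ∧
      S₀ k (unitaryOperators U) \ {0} ⊆ conjugate W (S : Set (H →L[ℂ] H)) ∧
      (¬ (k = 1 ∧ (0 : H →L[ℂ] H) ∉ S) →
        S₀ k (unitaryOperators U) ⊆ conjugate W (S : Set (H →L[ℂ] H))) ∧
      conjugate W (S : Set (H →L[ℂ] H)) ⊆ S₁ k (unitaryOperators U) := by
  obtain ⟨k, hk, ⟨e⟩⟩ := exists_index_equiv_minimalProjections hpi hirr hclosed hcompact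
  obtain ⟨r₀, U, W, hr₀, hU, hS₀, hzero, hS₁⟩ :=
    theorem3p13_general S hpi hirr hclosed hcompact e
  exact ⟨k, r₀, U, W, hk, hr₀, hU, hS₀, fun h => hzero fun h' =>
    h ⟨eq_one_of_subsingleton_index hk h'.1, h'.2⟩, hS₁⟩
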